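/- Let $\delta>0$, $t_0\in\mathbb{R}$, and let $q\colon\mathbb{R}\to\mathbb{R}$ be such that $q\in L^{\infty}(-\infty,t_0)$, there is $\eta>0$ with $q(t)\ge\eta$ for almost every $t\in\,]-\infty,t_0[$, and there is $c>0$ with $q\equiv c$ on $[t_0,+\infty[$. Let $f\colon[0,1]\to\mathbb{R}$ be a Lipschitz continuous bistable function, i.e. for some $\alpha\in\,]0,1[$ one has $f(0)=f(\alpha)=f(1)=0$, $f(s)<0$ for all $s\in\,]0,\alpha[$ and $f(s)>0$ for all $s\in\,]\alpha,1[$. Put $F(v)=\int_0^v f(s)\,\mathrm{d}s$ and assume $F(1)>0$. If $$c\le \eta\,\frac{-F(\alpha)}{F(1)-F(\alpha)},$$ then the equation $$\delta\left(\frac{v'}{\sqrt{1-(v')^2}}\right)'+q(t)f(v)=0,\qquad t\in\mathbb{R},$$ has a heteroclinic solution, that is, there exists a continuously differentiable, strictly increasing function $v\colon\mathbb{R}\to[0,1]$ with $|v'(t)|<1$ for every $t\in\mathbb{R}$ and $v'$ absolutely continuous on every compact interval, which satisfies the equation for almost every $t\in\mathbb{R}$ and is such that $\lim_{t\to-\infty}v(t)=0$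 and $\lim_{t\to+\infty}v(t)=1$. -/

import Mathlib

open MeasureTheory Set Filter Topology
open scoped NNReal ENNReal

/-- The one-dimensional Minkowski-curvature (Born–Infeld) function `φ ξ = ξ / √(1 - ξ²)`.
It is only meaningful for `|ξ| < 1`. -/
noncomputable def minkowskiPhi (ξ : ℝ) : ℝ := ξ / Real.sqrt (1 - ξ ^ 2)

/-- The primitive `F v = ∫₀ᵛ f` of the reaction term. -/
noncomputable def primitiveF (f : ℝ → ℝ) (v : ℝ) : ℝ := ∫ s in (0 : ℝ)..v, f s

/-- The sign condition on the reaction term: `f` vanishes at `0`, `α`, `β`, `1`, where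
`0 < α ≤ β < 1`, it is negative on `]0,α[` and positive on `]β,1[`.
Only the values of `f` on `[0,1]` matter. -/
structure SignCondition (f : ℝ → ℝ) (α β : ℝ) : Prop where
  alpha_mem : α ∈ Ioo (0 : ℝ) 1
  beta_mem : β ∈ Ioo (0 : ℝ) 1
  alpha_le_beta : α ≤ β
  map_zero : f 0 = 0
  map_one : f 1 = 0
  map_alpha : f α = 0
  map_beta : f β = 0
  neg : ∀ s ∈ Ioo (0 : ℝ) α, f s < 0
  pos : ∀ s ∈ Ioo β (1 : ℝ), 0 < f s

/-- `f` is bistable with intermediate zero `α`: the sign condition holds with `α = β`. -/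
def IsBistable (f : ℝ → ℝ) (α : ℝ) : Prop := SignCondition f α α

/-- `v` is a solution on the whole line of `δ (φ(v'))' + q(t) f(v) = 0`: it is continuously
differentiable with values in `[0,1]`, satisfies `|v'| < 1` (so that `φ(v')` makes sense),
`v'` is absolutely continuous on every compact interval, and the equation holds for almost
every `t`. -/
structure IsMinkowskiSolution (δ : ℝ) (q f v : ℝ → ℝ) : Prop where
  contDiff : ContDiff ℝ 1 v
  mem_Icc : ∀ t, v t ∈ Icc (0 : ℝ) 1
  abs_deriv_lt_one : ∀ t, |deriv v t| < 1
  deriv_absCont : ∀ a b : ℝ, AbsolutelyContinuousOnInterval (deriv v) a b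
  equation : ∀ᵐ t : ℝ, ∃ d : ℝ,
    HasDerivAt (fun s => minkowskiPhi (deriv v s)) d t ∧ δ * d + q t * f (v t) = 0

/-- A heteroclinic solution: a strictly increasing solution with `v(-∞) = 0`, `v(+∞) = 1`. -/
structure IsHeteroclinic (δ : ℝ) (q f v : ℝ → ℝ) : Prop where
  isSolution : IsMinkowskiSolution δ q f v
  strictMono : StrictMono v
  tendsto_atBot : Tendsto v atBot (𝓝 0)
  tendsto_atTop : Tendsto v atTop (𝓝 1)

/-! With `p = q / δ` and `y = φ(v')` the equation becomes the system `v' = ψ(y)`, `y' = -p f(v)`,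
where `ψ(y) = y / √(1 + y²)`. If `p` is a constant `μ`, the energy `√(1 + y²) + μ F(v)` is
conserved.

After `t₀` the weight is `κ = c / δ`. The energy level of the equilibrium `(1, 0)` is the curve `√(1
+ y²) = 1 + κ (F(1) - F(v))`. Since `F < F(1)` to the left of `1`, `y` cannot vanish on it before
`v` reaches `1`, so an orbit starting there with `v < 1`, `y > 0` increases to the equilibrium
(`exists_autonomous_connection`). It remains to find an orbit that emanates from `0` at `-∞` and
meets this curve at time `t₀`.

Before `t₀`, `f` is replaced by zero beyond `α`. Then `y` is nondecreasing and, as `p ≥ μ = η / δ`,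
so is the energy with weight `μ` as long as `y ≥ 0`. Shoot from `(0, s)` at time `a`. For `s = 0`
the orbit stays at the origin, below the curve. If `s > 0` and `v(t₀) ≥ α`, then `√(1 + y²) ≥ √(1 +
s²) - μ F(α) > 1 + κ (F(1) - F(α))` at `t₀`, above the curve: this is where the bound on `c` enters.
By continuity some `s` lands on the curve with `v(t₀) ≤ α`, where the truncation is invisible
(`exists_shooting`).

Shooting is done for continuous weights; a compactness argument then handles measurable `p` and `a →
-∞` together (`exists_integralSolution`). The landing condition survives in the limit and forces
`y(t₀) > 0`, which excludes the trivial limit (`IsIntegralSolutionOn.properties`).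
`isHeteroclinic_of_glue` joins the two halves. -/

/-- The inverse `y / √(1 + y²)` of `minkowskiPhi`. -/
noncomputable def minkowskiPsi (y : ℝ) : ℝ := y / Real.sqrt (1 + y ^ 2)

/-! ### Calculus of the inverse curvature function -/

theorem hasDerivAt_sqrt_one_add_sq (y : ℝ) :
    HasDerivAt (fun y : ℝ => Real.sqrt (1 + y ^ 2)) (minkowskiPsi y) y := by
  have h : (1 : ℝ) + y ^ 2 ≠ 0 := by positivity
  have h1 : HasDerivAt (fun y : ℝ => 1 + y ^ 2) (2 * y) y := by
    simpa using (hasDerivAt_pow 2 y).const_add 1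
  convert! h1.sqrt h using 1
  unfold minkowskiPsi
  rw [mul_div_mul_left _ _ two_ne_zero]

theorem hasDerivAt_minkowskiPsi (y : ℝ) :
    HasDerivAt minkowskiPsi (1 / Real.sqrt (1 + y ^ 2) ^ 3) y := by
  have h : (0 : ℝ) < 1 + y ^ 2 := by positivity
  have h0 : Real.sqrt (1 + y ^ 2) ≠ 0 := (Real.sqrt_pos.2 h).ne'
  convert! (hasDerivAt_id y).div (hasDerivAt_sqrt_one_add_sq y) h0 using 1
  have hs := Real.sq_sqrt h.le
  unfold minkowskiPsi
  simp only [id]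
  field_simp
  nlinarith

theorem one_le_sqrt_one_add_sq (y : ℝ) : 1 ≤ Real.sqrt (1 + y ^ 2) :=
  Real.one_le_sqrt.2 (by nlinarith)

theorem le_sqrt_one_add_sq (y : ℝ) : y ≤ Real.sqrt (1 + y ^ 2) :=
  Real.le_sqrt_of_sq_le (by linarith)

theorem differentiable_minkowskiPsi : Differentiable ℝ minkowskiPsi := fun y =>
  (hasDerivAt_minkowskiPsi y).differentiableAt

theorem lipschitzWith_minkowskiPsi : LipschitzWith 1 minkowskiPsi := by
  refine lipschitzWith_of_nnnorm_deriv_le differentiable_minkowskiPsi fun y => ?_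
  rw [(hasDerivAt_minkowskiPsi y).deriv, ← NNReal.coe_le_coe, coe_nnnorm, Real.norm_eq_abs]
  have h := one_le_sqrt_one_add_sq y
  rw [abs_of_nonneg (by positivity), NNReal.coe_one, div_le_one (by positivity)]
  exact one_le_pow₀ h

theorem strictMono_minkowskiPsi : StrictMono minkowskiPsi := by
  refine strictMono_of_deriv_pos fun y => ?_
  rw [(hasDerivAt_minkowskiPsi y).deriv]
  have h := one_le_sqrt_one_add_sq y
  positivity

@[simp] theorem minkowskiPsi_zero : minkowskiPsi 0 = 0 := by simp [minkowskiPsi]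

theorem minkowskiPsi_pos {y : ℝ} (hy : 0 < y) : 0 < minkowskiPsi y := by
  unfold minkowskiPsi; positivity

theorem minkowskiPsi_nonneg {y : ℝ} (hy : 0 ≤ y) : 0 ≤ minkowskiPsi y := by
  unfold minkowskiPsi; positivity

theorem abs_minkowskiPsi_lt_one (y : ℝ) : |minkowskiPsi y| < 1 := by
  have h : (0 : ℝ) < 1 + y ^ 2 := by positivity
  unfold minkowskiPsi
  rw [abs_div, abs_of_pos (Real.sqrt_pos.2 h), div_lt_one (Real.sqrt_pos.2 h),
    ← Real.sqrt_sq_eq_abs]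
  exact Real.sqrt_lt_sqrt (sq_nonneg y) (by linarith)

theorem minkowskiPsi_le_self {y : ℝ} (hy : 0 ≤ y) : minkowskiPsi y ≤ y :=
  div_le_self hy (one_le_sqrt_one_add_sq y)

theorem minkowskiPhi_minkowskiPsi (y : ℝ) : minkowskiPhi (minkowskiPsi y) = y := by
  have h : (0 : ℝ) < 1 + y ^ 2 := by positivity
  have h0 := Real.sqrt_pos.2 h
  have hs := Real.sq_sqrt h.le
  have h1 : 1 - minkowskiPsi y ^ 2 = (1 / Real.sqrt (1 + y ^ 2)) ^ 2 := by
    unfold minkowskiPsi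
    rw [div_pow, div_pow, hs]
    field_simp
    ring
  unfold minkowskiPhi
  rw [h1, Real.sqrt_sq (by positivity)]
  unfold minkowskiPsi
  field_simp

/-! ### Global solutions of the first order system -/

/-- A bounded vector field, continuous in time and globally Lipschitz in space, has global
integral curves. -/
theorem exists_global_integralCurve {E : Type*} [NormedAddCommGroup E] [NormedSpace ℝ E]
    [CompleteSpace E] {g : ℝ → E → E} {K C : ℝ≥0} (hK : ∀ t, LipschitzWith K (g t))
    (hcont : ∀ x, Continuous fun t => g t x) (hC : ∀ t x, ‖g t x‖ ≤ C) (t₀ : ℝ) (x₀ : E) :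
    ∃ u : ℝ → E, u t₀ = x₀ ∧ ∀ t, HasDerivAt u (g t (u t)) t := by
  have key : ∀ n : ℕ, ∃ u : ℝ → E, u t₀ = x₀ ∧
      ∀ t ∈ Ioo (t₀ - (n + 1)) (t₀ + (n + 1)), HasDerivAt u (g t (u t)) t := by
    intro n
    have hn : (0 : ℝ) < n + 1 := by positivity
    have ht : t₀ ∈ Icc (t₀ - (n + 1)) (t₀ + (n + 1)) := ⟨by linarith, by linarith⟩
    have hpl : IsPicardLindelof g (tmin := t₀ - (n + 1)) (tmax := t₀ + (n + 1)) ⟨t₀, ht⟩ x₀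
        (C * (n + 1)) 0 C K :=
      { lipschitzOnWith := fun t _ => (hK t).lipschitzOnWith
        continuousOn := fun x _ => (hcont x).continuousOn
        norm_le := fun t _ x _ => hC t x
        mul_max_le := by simp }
    obtain ⟨u, hu0, hu⟩ := hpl.exists_eq_forall_mem_Icc_hasDerivWithinAt₀
    exact ⟨u, hu0, fun t ht => (hu t (Ioo_subset_Icc_self ht)).hasDerivAt
      (Icc_mem_nhds ht.1 ht.2)⟩
  choose w hw0 hw using key
  have hle : ∀ n m : ℕ, n ≤ m → EqOn (w n) (w m) (Ioo (t₀ - (n + 1)) (t₀ + (n + 1))) := by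
    intro n m hnm
    have hnm' : (n : ℝ) ≤ m := by exact_mod_cast hnm
    have hn : (0 : ℝ) ≤ n := by positivity
    refine ODE_solution_unique_of_mem_Ioo (v := g) (s := fun _ => univ) (K := K) (t₀ := t₀)
      (fun t _ => (hK t).lipschitzOnWith) ⟨by linarith, by linarith⟩
      (fun t ht => ⟨hw n t ht, trivial⟩)
      (fun t ht => ⟨hw m t ⟨by linarith [ht.1], by linarith [ht.2]⟩, trivial⟩) ?_
    rw [hw0, hw0]
  have mem : ∀ t (n : ℕ), |t - t₀| < n + 1 → t ∈ Ioo (t₀ - (n + 1)) (t₀ + (n + 1)) := by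
    intro t n h
    rw [abs_lt] at h
    exact ⟨by linarith, by linarith⟩
  -- The index is large enough for `t` to lie in the open interval of the chosen solution; by
  -- uniqueness any larger index gives the same value.
  set u : ℝ → E := fun t => w ⌈|t - t₀|⌉₊ t with hu
  have huw : ∀ t (n : ℕ), |t - t₀| < n + 1 → u t = w n t := by
    intro t n h
    have h' : |t - t₀| < (⌈|t - t₀|⌉₊ : ℝ) + 1 := by linarith [Nat.le_ceil |t - t₀|]
    rcases le_total ⌈|t - t₀|⌉₊ n with hn | hn
    · exact hle _ _ hn (mem t _ h')
    · exact (hle _ _ hn (mem t _ h)).symm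
  refine ⟨u, by rw [huw t₀ 0 (by simp), hw0], fun t => ?_⟩
  set n := ⌈|t - t₀|⌉₊
  have h' : |t - t₀| < (n : ℝ) + 1 := by linarith [Nat.le_ceil |t - t₀|]
  have hev : u =ᶠ[𝓝 t] w n := by
    have : ∀ᶠ s in 𝓝 t, |s - t₀| < (n : ℝ) + 1 :=
      (by fun_prop : Continuous fun s : ℝ => |s - t₀|).continuousAt.eventually_lt
        continuousAt_const h'
    filter_upwards [this] with s hs using huw s n hs
  rw [huw t n h']
  exact (hw n t (mem t n h')).congr_of_eventuallyEq hev

/-- `v` and `y` solve the first order system `v' = y / √(1 + y²)`, `y' = -p(t) g(v)` everywhere. -/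
def IsSystemSolution (p g v y : ℝ → ℝ) : Prop :=
  ∀ t, HasDerivAt v (minkowskiPsi (y t)) t ∧ HasDerivAt y (-(p t * g (v t))) t

/-- The vector field of the first order system. -/
noncomputable def systemField (p g : ℝ → ℝ) (t : ℝ) (x : ℝ × ℝ) : ℝ × ℝ :=
  (minkowskiPsi x.2, -(p t * g x.1))

theorem isSystemSolution_iff {p g : ℝ → ℝ} {v y : ℝ → ℝ} :
    IsSystemSolution p g v y ↔
      ∀ t, HasDerivAt (fun s => (v s, y s)) (systemField p g t (v t, y t)) t := by
  refine forall_congr' fun t => ⟨fun h => h.1.prodMk h.2, fun h => ⟨?_, ?_⟩⟩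
  · exact (hasFDerivAt_fst.comp_hasDerivAt t h)
  · exact (hasFDerivAt_snd.comp_hasDerivAt t h)

theorem lipschitzWith_systemField {p g : ℝ → ℝ} {M L : ℝ≥0} (hp : ∀ t, |p t| ≤ M)
    (hg : LipschitzWith L g) (t : ℝ) : LipschitzWith (max 1 (M * L)) (systemField p g t) := by
  have h1 : LipschitzWith 1 fun x : ℝ × ℝ => minkowskiPsi x.2 := by
    simpa [Function.comp_def] using lipschitzWith_minkowskiPsi.comp LipschitzWith.prod_snd
  have h2 : LipschitzWith (M * L) fun x : ℝ × ℝ => -(p t * g x.1) := by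
    refine LipschitzWith.of_dist_le_mul fun x y => ?_
    have := hg.dist_le_mul x.1 y.1
    have h3 : dist x.1 y.1 ≤ dist x y := le_max_left _ _
    rw [Real.dist_eq] at this ⊢
    rw [show -(p t * g x.1) - -(p t * g y.1) = -(p t * (g x.1 - g y.1)) by ring, abs_neg, abs_mul]
    calc |p t| * |g x.1 - g y.1| ≤ M * (L * dist x.1 y.1) := by gcongr; exact hp t
      _ ≤ M * (L * dist x y) := by gcongr
      _ = _ := by push_cast; ring
  exact h1.prodMk h2

theorem exists_isSystemSolution {p g : ℝ → ℝ} {M L C : ℝ≥0} (hpc : Continuous p)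
    (hp : ∀ t, |p t| ≤ M) (hg : LipschitzWith L g) (hgC : ∀ x, |g x| ≤ C) (t₀ v₀ y₀ : ℝ) :
    ∃ v y : ℝ → ℝ, IsSystemSolution p g v y ∧ v t₀ = v₀ ∧ y t₀ = y₀ := by
  obtain ⟨u, hu0, hu⟩ := exists_global_integralCurve (C := max 1 (M * C))
    (lipschitzWith_systemField hp hg)
    (fun x => by unfold systemField; fun_prop) (fun t x => by
      rw [systemField, Prod.norm_def, NNReal.coe_max]
      refine max_le_max (by simpa using (abs_minkowskiPsi_lt_one x.2).le) ?_
      rw [norm_neg, norm_mul, NNReal.coe_mul]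
      exact mul_le_mul (hp t) (hgC _) (norm_nonneg _) M.2) t₀ (v₀, y₀)
  exact ⟨fun t => (u t).1, fun t => (u t).2, isSystemSolution_iff.2 hu, by simp [hu0],
    by simp [hu0]⟩

namespace IsSystemSolution

variable {p g v y v' y' : ℝ → ℝ}

theorem continuous_fst (h : IsSystemSolution p g v y) : Continuous v :=
  continuous_iff_continuousAt.2 fun t => (h t).1.continuousAt

theorem continuous_snd (h : IsSystemSolution p g v y) : Continuous y :=
  continuous_iff_continuousAt.2 fun t => (h t).2.continuousAt

theorem dist_le {M L : ℝ≥0} (hp : ∀ t, |p t| ≤ M) (hg : LipschitzWith L g)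
    (h : IsSystemSolution p g v y) (h' : IsSystemSolution p g v' y') {a b : ℝ} (hab : a ≤ b) :
    dist (v b, y b) (v' b, y' b) ≤
      dist (v a, y a) (v' a, y' a) * Real.exp ((max 1 (M * L) : ℝ≥0) * (b - a)) := by
  refine dist_le_of_trajectories_ODE (f := fun s => (v s, y s)) (g := fun s => (v' s, y' s))
    (lipschitzWith_systemField hp hg)
    (h.continuous_fst.prodMk h.continuous_snd).continuousOn
    (fun t _ => (isSystemSolution_iff.1 h t).hasDerivWithinAt)
    (h'.continuous_fst.prodMk h'.continuous_snd).continuousOn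
    (fun t _ => (isSystemSolution_iff.1 h' t).hasDerivWithinAt) le_rfl b ⟨hab, le_rfl⟩

theorem unique {M L : ℝ≥0} (hp : ∀ t, |p t| ≤ M) (hg : LipschitzWith L g)
    (h : IsSystemSolution p g v y) (h' : IsSystemSolution p g v' y') {a : ℝ}
    (hv : v a = v' a) (hy : y a = y' a) (t : ℝ) : v t = v' t ∧ y t = y' t := by
  have := ODE_solution_unique_univ (s := fun _ => univ) (t₀ := a)
    (fun t => (lipschitzWith_systemField hp hg t).lipschitzOnWith)
    (fun t => ⟨isSystemSolution_iff.1 h t, trivial⟩)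
    (fun t => ⟨isSystemSolution_iff.1 h' t, trivial⟩) (by simp [hv, hy])
  simpa using congrFun this t

end IsSystemSolution

/-! ### Monotonicity and energy -/

theorem sqrt_one_add_sq_le {y : ℝ} (hy : 0 ≤ y) : Real.sqrt (1 + y ^ 2) ≤ 1 + y :=
  Real.sqrt_le_iff.2 ⟨by linarith, by nlinarith⟩

theorem one_lt_sqrt_one_add_sq {y : ℝ} (hy : y ≠ 0) : 1 < Real.sqrt (1 + y ^ 2) := by
  have : 0 < y ^ 2 := by positivity
  exact Real.lt_sqrt_of_sq_lt (by linarith)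

namespace IsSystemSolution

variable {p g v y : ℝ → ℝ} {a : ℝ}

theorem monotone_snd (h : IsSystemSolution p g v y) (hp : ∀ t, 0 ≤ p t) (hg : ∀ x, g x ≤ 0) :
    Monotone y :=
  monotone_of_hasDerivAt_nonneg (fun t => (h t).2) fun t => by
    have := mul_nonpos_of_nonneg_of_nonpos (hp t) (hg (v t))
    simp only [Pi.zero_apply]
    linarith

theorem monotoneOn_fst (h : IsSystemSolution p g v y) (hp : ∀ t, 0 ≤ p t) (hg : ∀ x, g x ≤ 0)
    (ha : 0 ≤ y a) : MonotoneOn v (Ici a) := by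
  refine monotoneOn_of_deriv_nonneg (convex_Ici a) h.continuous_fst.continuousOn
    (fun t _ => (h t).1.differentiableAt.differentiableWithinAt) fun t ht => ?_
  rw [interior_Ici, mem_Ioi] at ht
  rw [(h t).1.deriv]
  exact minkowskiPsi_nonneg (ha.trans (h.monotone_snd hp hg ht.le))

theorem lipschitzWith_fst (h : IsSystemSolution p g v y) : LipschitzWith 1 v := by
  refine lipschitzWith_of_nnnorm_deriv_le (fun t => (h t).1.differentiableAt) fun t => ?_
  rw [(h t).1.deriv]
  exact (abs_minkowskiPsi_lt_one (y t)).le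

theorem lipschitzWith_snd (h : IsSystemSolution p g v y) {M C : ℝ≥0} (hp : ∀ t, |p t| ≤ M)
    (hg : ∀ x, |g x| ≤ C) : LipschitzWith (M * C) y := by
  refine lipschitzWith_of_nnnorm_deriv_le (fun t => (h t).2.differentiableAt) fun t => ?_
  rw [(h t).2.deriv, ← NNReal.coe_le_coe, coe_nnnorm, norm_neg, norm_mul, NNReal.coe_mul]
  exact mul_le_mul (hp t) (hg _) (norm_nonneg _) M.2

/-- The weight `μ` is free: `μ = p` gives conservation in the autonomous case, and `μ ≤ p` gives a
quantity that increases when `g ≤ 0` and `y ≥ 0`. -/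
theorem hasDerivAt_energy (h : IsSystemSolution p g v y) {Φ : ℝ → ℝ}
    (hΦ : ∀ x, HasDerivAt Φ (g x) x) (μ t : ℝ) :
    HasDerivAt (fun t => Real.sqrt (1 + y t ^ 2) + μ * Φ (v t))
      (minkowskiPsi (y t) * (g (v t) * (μ - p t))) t := by
  have h1 := (hasDerivAt_sqrt_one_add_sq (y t)).comp t (h t).2
  have h2 := ((hΦ (v t)).comp t (h t).1).const_mul μ
  convert! h1.add h2 using 1
  ring

theorem energy_le (h : IsSystemSolution p g v y) {Φ : ℝ → ℝ} (hΦ : ∀ x, HasDerivAt Φ (g x) x)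
    {μ : ℝ} (hμ : 0 ≤ μ) (hp : ∀ t, μ ≤ p t) (hg : ∀ x, g x ≤ 0) (ha : 0 ≤ y a) {t : ℝ}
    (hat : a ≤ t) :
    Real.sqrt (1 + y a ^ 2) + μ * Φ (v a) ≤ Real.sqrt (1 + y t ^ 2) + μ * Φ (v t) := by
  have : MonotoneOn (fun t => Real.sqrt (1 + y t ^ 2) + μ * Φ (v t)) (Ici a) := by
    refine monotoneOn_of_deriv_nonneg (convex_Ici a)
      (fun t _ => (h.hasDerivAt_energy hΦ μ t).continuousAt.continuousWithinAt)
      (fun t _ => (h.hasDerivAt_energy hΦ μ t).differentiableAt.differentiableWithinAt)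
      fun t ht => ?_
    rw [interior_Ici, mem_Ioi] at ht
    rw [(h.hasDerivAt_energy hΦ μ t).deriv]
    refine mul_nonneg (minkowskiPsi_nonneg
      (ha.trans (h.monotone_snd (fun t => hμ.trans (hp t)) hg ht.le)))
      (mul_nonneg_of_nonpos_of_nonpos (hg _) (by linarith [hp t]))
  exact this self_mem_Ici hat hat

end IsSystemSolution

/-! ### Shooting onto the target energy level -/

/-- Shooting from `(0, s)` at time `a`, the parameter `s` can be chosen so that at time `t₀` the
trajectory lies on the level set `√(1 + y²) = 1 + κ (F₁ - Φ v)`. -/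
theorem exists_shooting {p g Φ : ℝ → ℝ} {M L C : ℝ≥0} {α μ κ F₁ a t₀ : ℝ} (hpc : Continuous p)
    (hμ : 0 ≤ μ) (hpμ : ∀ t, μ ≤ p t) (hpM : ∀ t, p t ≤ M) (hg : LipschitzWith L g)
    (hgC : ∀ x, |g x| ≤ C) (hg0 : g 0 = 0) (hgneg : ∀ x, g x ≤ 0)
    (hΦ : ∀ x, HasDerivAt Φ (g x) x) (hΦ0 : Φ 0 = 0) (hα1 : α ≤ 1)
    (hΦα : ∀ x, α ≤ x → Φ x = Φ α) (hF₁ : 0 < F₁) (hκ : 0 < κ)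
    (hcond : κ * (F₁ - Φ α) ≤ -(μ * Φ α)) (hat : a + 2 ≤ t₀) :
    ∃ v y : ℝ → ℝ, IsSystemSolution p g v y ∧ v a = 0 ∧ 0 < y a ∧ v t₀ ≤ α ∧
      Real.sqrt (1 + y t₀ ^ 2) = 1 + κ * (F₁ - Φ (v t₀)) := by
  have hp0 : ∀ t, 0 ≤ p t := fun t => hμ.trans (hpμ t)
  have hpabs : ∀ t, |p t| ≤ M := fun t => by rw [abs_of_nonneg (hp0 t)]; exact hpM t
  choose v y hsol hv0 hy0 using fun s => exists_isSystemSolution hpc hpabs hg hgC a 0 s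
  have hat' : a ≤ t₀ := by linarith
  -- Grönwall's inequality makes the end point Lipschitz in `s`, because the initial points differ
  -- only in their second coordinate.
  have hcont : Continuous fun s => (v s t₀, y s t₀) := by
    set E := Real.exp ((max 1 (M * L) : ℝ≥0) * (t₀ - a)) with hE
    refine (LipschitzWith.of_dist_le_mul (K := ⟨E, (Real.exp_pos _).le⟩) fun s s' => ?_).continuous
    have := (hsol s).dist_le hpabs hg (hsol s') hat'
    rw [hv0, hy0, hv0, hy0, Prod.dist_eq (x := (0, s)), dist_self,
      max_eq_right dist_nonneg, mul_comm] at this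
    exact this
  have hΦc : Continuous Φ := continuous_iff_continuousAt.2 fun x => (hΦ x).continuousAt
  set G : ℝ → ℝ := fun s => Real.sqrt (1 + y s t₀ ^ 2) - (1 + κ * (F₁ - Φ (v s t₀))) with hG
  have hGc : Continuous G := by
    have h1 : Continuous fun s => v s t₀ := continuous_fst.comp hcont
    have h2 : Continuous fun s => y s t₀ := continuous_snd.comp hcont
    have h3 := hΦc.comp h1
    exact (by fun_prop : Continuous fun s => Real.sqrt (1 + y s t₀ ^ 2)).sub
      (continuous_const.add (continuous_const.mul (continuous_const.sub h3)))
  have hG0 : G 0 < 0 := by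
    have hz : IsSystemSolution p g (fun _ => 0) (fun _ => 0) := fun t =>
      ⟨by simpa using hasDerivAt_const t (0 : ℝ), by simpa [hg0] using hasDerivAt_const t (0 : ℝ)⟩
    obtain ⟨h1, h2⟩ := (hsol 0).unique hpabs hg hz (hv0 0) (hy0 0) t₀
    have : 0 < κ * F₁ := mul_pos hκ hF₁
    simp only [hG, h1, h2, hΦ0]
    norm_num
    linarith
  -- Beyond `α` the primitive is frozen at `Φ α`, so monotonicity of the energy and `hcond` place
  -- the end point strictly above the curve.
  have hGpos : ∀ s, 0 < s → α ≤ v s t₀ → 0 < G s := by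
    intro s hs hsα
    have := (hsol s).energy_le hΦ hμ hpμ hgneg (by rw [hy0]; exact hs.le) hat'
    rw [hy0, hv0, hΦ0, hΦα _ hsα] at this
    have h1 := one_lt_sqrt_one_add_sq hs.ne'
    simp only [hG, hΦα _ hsα]
    linarith
  -- For `s = 1` the speed is at least `ψ(1) ≥ 1/2`, so a time span of at least `2` carries `v` from
  -- `0` past `1 ≥ α`.
  have hG1 : 0 < G 1 := by
    refine hGpos 1 one_pos (hα1.trans ?_)
    have hy1 : ∀ t, a ≤ t → 1 ≤ y 1 t := fun t ht => by
      have := (hsol 1).monotone_snd hp0 hgneg ht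
      rwa [hy0] at this
    have h2 : minkowskiPsi 1 * (t₀ - a) ≤ v 1 t₀ - v 1 a := by
      refine (convex_Ici a).mul_sub_le_image_sub_of_le_deriv
        (hsol 1).continuous_fst.continuousOn
        (fun t _ => (hsol 1 t).1.differentiableAt.differentiableWithinAt) (fun t ht => ?_)
        a self_mem_Ici t₀ hat' hat'
      rw [interior_Ici, mem_Ioi] at ht
      rw [(hsol 1 t).1.deriv]
      exact strictMono_minkowskiPsi.monotone (hy1 t ht.le)
    have h3 : 1 / 2 ≤ minkowskiPsi 1 := by
      unfold minkowskiPsi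
      refine one_div_le_one_div_of_le (by positivity) (Real.sqrt_le_iff.2 ⟨by norm_num, by norm_num⟩)
    rw [hv0] at h2
    nlinarith
  obtain ⟨s, hs, hGs⟩ := intermediate_value_Icc zero_le_one hGc.continuousOn
    ⟨hG0.le, hG1.le⟩
  have hs0 : 0 < s := by
    refine lt_of_le_of_ne hs.1 ?_
    rintro rfl
    exact hG0.ne hGs
  refine ⟨v s, y s, hsol s, hv0 s, by rwa [hy0], ?_, by linarith [sub_eq_zero.1 hGs]⟩
  by_contra! h
  exact (hGpos s hs0 h.le).ne' hGs

/-! ### Approximation and compactness -/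

/-- A bounded measurable function is the almost everywhere limit of continuous functions obeying
the same bounds. -/
theorem exists_continuous_tendsto_ae {p : ℝ → ℝ} (hpm : Measurable p) {μ M : ℝ}
    (hμ : ∀ t, μ ≤ p t) (hM : ∀ t, p t ≤ M) :
    ∃ P : ℕ → ℝ → ℝ, (∀ n, Continuous (P n)) ∧ (∀ n t, μ ≤ P n t) ∧ (∀ n t, P n t ≤ M) ∧
      ∀ᵐ t, Tendsto (fun n => P n t) atTop (𝓝 (p t)) := by
  have hloc : LocallyIntegrable p volume := by
    refine (locallyIntegrable_const (max |μ| |M|)).mono hpm.aestronglyMeasurable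
      (Eventually.of_forall fun t => ?_)
    rw [Real.norm_eq_abs, Real.norm_eq_abs, abs_of_nonneg (le_max_of_le_left (abs_nonneg μ))]
    exact abs_le_max_abs_abs (hμ t) (hM t)
  have hint : ∀ a b, IntervalIntegrable p volume a b := fun a b =>
    intervalIntegrable_iff.2 ((hloc.integrableOn_isCompact isCompact_uIcc).mono_set
      uIoc_subset_uIcc)
  -- Averages of `p` over `[t, t + 1/(n+1)]`: continuous, within the same bounds, and convergent at
  -- Lebesgue points.
  refine ⟨fun n t => ((1 : ℝ) / (n + 1))⁻¹ *
    ((∫ s in (0 : ℝ)..(t + 1 / (n + 1)), p s) - ∫ s in (0 : ℝ)..t, p s), fun n => ?_, fun n t => ?_,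
    fun n t => ?_, ?_⟩
  · have hc := intervalIntegral.continuous_primitive hint 0
    exact continuous_const.mul ((hc.comp (continuous_id.add continuous_const)).sub hc)
  · have hn : (0 : ℝ) < 1 / (n + 1) := by positivity
    have := intervalIntegral.integral_mono_on (a := t) (b := t + 1 / (n + 1)) (by linarith)
      (intervalIntegrable_const (c := μ)) (hint _ _) fun s _ => hμ s
    dsimp only
    rw [intervalIntegral.integral_interval_sub_left (hint _ _) (hint _ _), inv_mul_eq_div,
      le_div_iff₀ hn]
    simpa [mul_comm] using this
  · have hn : (0 : ℝ) < 1 / (n + 1) := by positivity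
    have := intervalIntegral.integral_mono_on (a := t) (b := t + 1 / (n + 1)) (by linarith)
      (hint _ _) (intervalIntegrable_const (c := M)) fun s _ => hM s
    dsimp only
    rw [intervalIntegral.integral_interval_sub_left (hint _ _) (hint _ _), inv_mul_eq_div,
      div_le_iff₀ hn]
    simpa [mul_comm] using this
  · filter_upwards [LocallyIntegrable.ae_hasDerivAt_integral hloc] with t ht
    have h1 := hasDerivAt_iff_tendsto_slope_zero.1 (ht 0)
    have h2 : Tendsto (fun n : ℕ => (1 : ℝ) / (n + 1)) atTop (𝓝[≠] 0) :=
      tendsto_nhdsWithin_iff.2 ⟨tendsto_one_div_add_atTop_nhds_zero_nat,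
        Eventually.of_forall fun n => by simp only [mem_compl_iff, mem_singleton_iff]; positivity⟩
    exact h1.comp h2

/-- A uniformly bounded equi-Lipschitz sequence of functions on the line has a pointwise convergent
subsequence, with Lipschitz limit. -/
theorem exists_subseq_tendsto_of_lipschitzWith {X : Type*} [MetricSpace X] [ProperSpace X]
    {u : ℕ → ℝ → X} {K : ℝ≥0} {x₀ : X} {C : ℝ} (hK : ∀ n, LipschitzWith K (u n))
    (hC : ∀ n t, u n t ∈ Metric.closedBall x₀ C) :
    ∃ φ : ℕ → ℕ, StrictMono φ ∧ ∃ U : ℝ → X, LipschitzWith K U ∧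
      ∀ t, Tendsto (fun n => u (φ n) t) atTop (𝓝 (U t)) := by
  -- Tychonoff's theorem gives convergence at all rational times; the common Lipschitz constant
  -- extends it to every real time.
  have hcomp : IsCompact (Set.univ.pi fun _ : ℚ => Metric.closedBall x₀ C) :=
    isCompact_univ_pi fun _ => isCompact_closedBall x₀ C
  obtain ⟨w, -, φ, hφ, hw⟩ := hcomp.tendsto_subseq (x := fun n (r : ℚ) => u n r)
    fun n r _ => hC n r
  rw [tendsto_pi_nhds] at hw
  have hlim : ∀ t, ∃ x, Tendsto (fun n => u (φ n) t) atTop (𝓝 x) := by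
    intro t
    refine cauchySeq_tendsto_of_complete (Metric.cauchySeq_iff.2 fun ε hε => ?_)
    obtain ⟨r, hr1, hr2⟩ := exists_rat_btwn (show t < t + ε / (3 * (K + 1)) from
      lt_add_of_pos_right t (by positivity))
    obtain ⟨N, hN⟩ := Metric.cauchySeq_iff.1 (hw r).cauchySeq (ε / 3) (by positivity)
    have hd : ∀ n, dist (u (φ n) t) (u (φ n) r) < ε / 3 := by
      intro n
      have h1 : dist t (r : ℝ) < ε / (3 * (K + 1)) := by
        rw [dist_comm, Real.dist_eq, abs_of_pos] <;> linarith
      calc dist (u (φ n) t) (u (φ n) r) ≤ K * dist t (r : ℝ) := (hK _).dist_le_mul _ _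
        _ ≤ (K + 1) * dist t (r : ℝ) := by gcongr; linarith
        _ < (K + 1) * (ε / (3 * (K + 1))) := by gcongr
        _ = ε / 3 := by field_simp
    refine ⟨N, fun m hm n hn => ?_⟩
    have h1 := hN m hm n hn
    simp only [Function.comp_apply] at h1
    have h2 := dist_triangle4 (u (φ m) t) (u (φ m) r) (u (φ n) r) (u (φ n) t)
    have h3 := hd n
    rw [dist_comm] at h3
    linarith [hd m]
  choose U hU using hlim
  exact ⟨φ, hφ, U, LipschitzWith.of_dist_le_mul fun s t =>
    le_of_tendsto ((hU s).dist (hU t)) (Eventually.of_forall fun n => (hK _).dist_le_mul s t), hU⟩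

/-! ### The orbit on `]-∞, t₀]` -/

theorem not_bddBelow_of_linear_growth {U : ℝ → ℝ} {ε T B : ℝ} (hε : 0 < ε)
    (hU : ∀ s ≤ T, ε * (T - s) ≤ U T - U s) (hB : ∀ s, B ≤ U s) : False := by
  have h1 := hU (T - (U T - B + 1) / ε)
    (sub_le_self _ (div_nonneg (by linarith [hB T]) hε.le))
  rw [sub_sub_cancel, mul_div_cancel₀ _ hε.ne'] at h1
  linarith [hB (T - (U T - B + 1) / ε)]

/-- The integrated system on `]-∞, t₀]`. -/
structure IsIntegralSolutionOn (p g v y : ℝ → ℝ) (t₀ : ℝ) : Prop where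
  fst : ∀ s t, s ≤ t → t ≤ t₀ → v t - v s = ∫ r in s..t, minkowskiPsi (y r)
  snd : ∀ s t, s ≤ t → t ≤ t₀ → y t - y s = ∫ r in s..t, -(p r * g (v r))

/-- Approximate weights converge only almost everywhere, so the limit is taken in the integrated
equations, by dominated convergence. -/
theorem exists_integralSolution {p g Φ : ℝ → ℝ} {M L C : ℝ≥0} {α μ κ F₁ t₀ : ℝ}
    (hpm : Measurable p)
    (hμ : 0 ≤ μ) (hpμ : ∀ t, μ ≤ p t) (hpM : ∀ t, p t ≤ M) (hg : LipschitzWith L g)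
    (hgC : ∀ x, |g x| ≤ C) (hg0 : g 0 = 0) (hgneg : ∀ x, g x ≤ 0)
    (hΦ : ∀ x, HasDerivAt Φ (g x) x) (hΦ0 : Φ 0 = 0) (hα1 : α ≤ 1)
    (hΦα : ∀ x, α ≤ x → Φ x = Φ α) (hF₁ : 0 < F₁) (hκ : 0 < κ)
    (hcond : κ * (F₁ - Φ α) ≤ -(μ * Φ α)) :
    ∃ v y : ℝ → ℝ, IsIntegralSolutionOn p g v y t₀ ∧ LipschitzWith (max 1 (M * C)) v ∧
      LipschitzWith (max 1 (M * C)) y ∧ Monotone v ∧ Monotone y ∧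
      (∀ t, 0 ≤ v t) ∧ (∀ t, v t ≤ α) ∧ (∀ t, 0 ≤ y t) ∧
      Real.sqrt (1 + y t₀ ^ 2) = 1 + κ * (F₁ - Φ (v t₀)) := by
  obtain ⟨P, hPc, hPμ, hPM, hPlim⟩ := exists_continuous_tendsto_ae hpm hpμ hpM
  have hPabs : ∀ n t, |P n t| ≤ M := fun n t => by
    rw [abs_of_nonneg (hμ.trans (hPμ n t))]; exact hPM n t
  set a : ℕ → ℝ := fun n => t₀ - 2 - n with ha
  have hat : ∀ n, a n + 2 ≤ t₀ := fun n => by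
    have : (0 : ℝ) ≤ n := n.cast_nonneg
    simp only [ha]; linarith
  choose v y hsol hva hya hvα hE using fun n => exists_shooting (hPc n) hμ (hPμ n) (hPM n) hg hgC
    hg0 hgneg hΦ hΦ0 hα1 hΦα hF₁ hκ hcond (hat n)
  have hP0 : ∀ n t, 0 ≤ P n t := fun n t => hμ.trans (hPμ n t)
  -- Time is clamped to `[a n, t₀]`, where the bounds on `v` and `y` hold; each fixed `t ≤ t₀` is
  -- eventually unaffected.
  set k : ℕ → ℝ → ℝ := fun n t => max (a n) (min t t₀) with hk
  have hka : ∀ n t, a n ≤ k n t := fun n t => le_max_left _ _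
  have hkt : ∀ n t, k n t ≤ t₀ := fun n t => max_le (by linarith [hat n]) (min_le_right _ _)
  have hkeq : ∀ n t, a n ≤ t → t ≤ t₀ → k n t = t := fun n t h1 h2 => by
    simp [hk, h1, h2]
  have hkmono : ∀ n, Monotone (k n) := fun n s t h => max_le_max_left _ (min_le_min_right _ h)
  have hkL : ∀ n, LipschitzWith 1 (k n) := fun n =>
    (LipschitzWith.id.min_const t₀).const_max (a n)
  have hvmono : ∀ n, MonotoneOn (v n) (Ici (a n)) := fun n =>
    (hsol n).monotoneOn_fst (hP0 n) hgneg (hya n).le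
  have hymono : ∀ n, Monotone (y n) := fun n => (hsol n).monotone_snd (hP0 n) hgneg
  have hv0 : ∀ n t, 0 ≤ v n (k n t) := fun n t => by
    rw [← hva n]; exact hvmono n self_mem_Ici (hka n t) (hka n t)
  have hv1 : ∀ n t, v n (k n t) ≤ α := fun n t =>
    (hvmono n (hka n t) (by simp only [mem_Ici]; linarith [hat n]) (hkt n t)).trans (hvα n)
  have hy0 : ∀ n t, 0 ≤ y n (k n t) := fun n t => (hya n).le.trans (hymono n (hka n t))
  have hΦanti : Antitone Φ := antitone_of_hasDerivAt_nonpos hΦ hgneg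
  set B : ℝ := 1 + κ * (F₁ - Φ α) with hB
  have hy1 : ∀ n t, y n (k n t) ≤ B := fun n t => by
    refine (hymono n (hkt n t)).trans ((le_sqrt_one_add_sq _).trans ?_)
    rw [hE n]
    have := hΦanti (hvα n)
    rw [hB]
    gcongr
  obtain ⟨φ, hφ, U, hUL, hU⟩ := exists_subseq_tendsto_of_lipschitzWith
    (u := fun n t => (v n (k n t), y n (k n t))) (K := max 1 (M * C)) (x₀ := 0) (C := max 1 B)
    (fun n => by
      simpa [Function.comp_def] using (((hsol n).lipschitzWith_fst.comp (hkL n)).prodMk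
        (((hsol n).lipschitzWith_snd (hPabs n) hgC).comp (hkL n))))
    (fun n t => by
      rw [mem_closedBall_zero_iff, Prod.norm_def]
      refine max_le_max ?_ ?_
      · rw [Real.norm_of_nonneg (hv0 n t)]; exact (hv1 n t).trans hα1
      · rw [Real.norm_of_nonneg (hy0 n t)]; exact hy1 n t)
  have hUv : ∀ t, Tendsto (fun n => v (φ n) (k (φ n) t)) atTop (𝓝 (U t).1) := fun t =>
    (continuous_fst.tendsto _).comp (hU t)
  have hUy : ∀ t, Tendsto (fun n => y (φ n) (k (φ n) t)) atTop (𝓝 (U t).2) := fun t =>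
    (continuous_snd.tendsto _).comp (hU t)
  have hev : ∀ s, ∀ᶠ n in atTop, a (φ n) ≤ s := fun s => by
    have h1 : Tendsto (fun n => ((φ n : ℕ) : ℝ)) atTop atTop :=
      tendsto_natCast_atTop_atTop.comp hφ.tendsto_atTop
    filter_upwards [h1.eventually_ge_atTop (t₀ - 2 - s)] with n hn
    simp only [ha]; linarith
  have hUv' : ∀ t, t ≤ t₀ → Tendsto (fun n => v (φ n) t) atTop (𝓝 (U t).1) := fun t ht => by
    refine (hUv t).congr' ?_
    filter_upwards [hev t] with n hn
    rw [hkeq _ _ hn ht]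
  have hUy' : ∀ t, t ≤ t₀ → Tendsto (fun n => y (φ n) t) atTop (𝓝 (U t).2) := fun t ht => by
    refine (hUy t).congr' ?_
    filter_upwards [hev t] with n hn
    rw [hkeq _ _ hn ht]
  have hΨc : Continuous minkowskiPsi := lipschitzWith_minkowskiPsi.continuous
  have hgc : Continuous g := hg.continuous
  have hΦc : Continuous Φ := continuous_iff_continuousAt.2 fun x => (hΦ x).continuousAt
  refine ⟨fun t => (U t).1, fun t => (U t).2, ⟨fun s t hst ht => ?_, fun s t hst ht => ?_⟩,
    ?_, ?_, fun s t hst => ?_, fun s t hst => ?_, fun t => ?_, fun t => ?_, fun t => ?_, ?_⟩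
  · have h1 : Tendsto (fun n => ∫ r in s..t, minkowskiPsi (y (φ n) r)) atTop
        (𝓝 (∫ r in s..t, minkowskiPsi (U r).2)) := by
      refine intervalIntegral.tendsto_integral_filter_of_dominated_convergence (fun _ => 1)
        (Eventually.of_forall fun n =>
          (hΨc.comp (hsol (φ n)).continuous_snd).aestronglyMeasurable)
        (Eventually.of_forall fun n => Eventually.of_forall fun r _ =>
          (abs_minkowskiPsi_lt_one _).le)
        intervalIntegrable_const (Eventually.of_forall fun r hr => ?_)
      rw [uIoc_of_le hst] at hr
      exact (hΨc.tendsto _).comp (hUy' r (hr.2.trans ht))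
    refine tendsto_nhds_unique ((hUv' t ht).sub (hUv' s (hst.trans ht))) (h1.congr fun n => ?_)
    exact intervalIntegral.integral_eq_sub_of_hasDerivAt (fun r _ => (hsol (φ n) r).1)
      ((hΨc.comp (hsol (φ n)).continuous_snd).intervalIntegrable _ _)
  · have hc : ∀ n, Continuous fun r => -(P (φ n) r * g (v (φ n) r)) := fun n =>
      ((hPc _).mul (hgc.comp (hsol (φ n)).continuous_fst)).neg
    have h1 : Tendsto (fun n => ∫ r in s..t, -(P (φ n) r * g (v (φ n) r))) atTop
        (𝓝 (∫ r in s..t, -(p r * g (U r).1))) := by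
      refine intervalIntegral.tendsto_integral_filter_of_dominated_convergence (fun _ => M * C)
        (Eventually.of_forall fun n => (hc n).aestronglyMeasurable)
        (Eventually.of_forall fun n => Eventually.of_forall fun r _ => ?_)
        intervalIntegrable_const ?_
      · rw [norm_neg, norm_mul]
        exact mul_le_mul (hPabs _ _) (hgC _) (norm_nonneg _) M.2
      · filter_upwards [hPlim] with r hPr hr
        rw [uIoc_of_le hst] at hr
        exact ((hPr.comp hφ.tendsto_atTop).mul
          ((hgc.tendsto _).comp (hUv' r (hr.2.trans ht)))).neg
    refine tendsto_nhds_unique ((hUy' t ht).sub (hUy' s (hst.trans ht))) (h1.congr fun n => ?_)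
    exact intervalIntegral.integral_eq_sub_of_hasDerivAt (fun r _ => (hsol (φ n) r).2)
      ((hc n).intervalIntegrable _ _)
  · simpa [Function.comp_def] using LipschitzWith.prod_fst.comp hUL
  · simpa [Function.comp_def] using LipschitzWith.prod_snd.comp hUL
  · exact le_of_tendsto_of_tendsto' (hUv s) (hUv t) fun n =>
      hvmono _ (hka _ _) (hka _ _) (hkmono _ hst)
  · exact le_of_tendsto_of_tendsto' (hUy s) (hUy t) fun n => hymono _ (hkmono _ hst)
  · exact ge_of_tendsto' (hUv t) fun n => hv0 _ _
  · exact le_of_tendsto' (hUv t) fun n => hv1 _ _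
  · exact ge_of_tendsto' (hUy t) fun n => hy0 _ _
  · have h1 := (hUy' t₀ le_rfl)
    have h2 := ((hΦc.tendsto _).comp (hUv' t₀ le_rfl))
    have h3 : Tendsto (fun n => Real.sqrt (1 + y (φ n) t₀ ^ 2)) atTop
        (𝓝 (Real.sqrt (1 + (U t₀).2 ^ 2))) := ((h1.pow 2).const_add 1).sqrt
    refine tendsto_nhds_unique h3 ((((h2.const_sub F₁).const_mul κ).const_add 1).congr fun n => ?_)
    exact (hE (φ n)).symm

/-- The monotone bounded pair has a limit at `-∞`, which must be an equilibrium since otherwise one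
component would be unbounded below. The equilibrium `(α, 0)` is excluded by `y t₀ > 0`, and so is a
zero of `y`, by uniqueness at the origin. -/
theorem IsIntegralSolutionOn.properties {p g v y : ℝ → ℝ} {M L : ℝ≥0} {α μ t₀ : ℝ}
    (h : IsIntegralSolutionOn p g v y t₀) (hpm : Measurable p)
    (hμ : 0 < μ) (hpμ : ∀ t, μ ≤ p t) (hpM : ∀ t, p t ≤ M) (hg : LipschitzWith L g)
    (hg0 : g 0 = 0) (hgα : g α = 0) (hgneg : ∀ x ∈ Ioo 0 α, g x < 0)
    (hvc : Continuous v) (hyc : Continuous y) (hvm : Monotone v) (hym : Monotone y)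
    (hv0 : ∀ t, 0 ≤ v t) (hvα : ∀ t, v t ≤ α) (hy0 : ∀ t, 0 ≤ y t) (hyt₀ : 0 < y t₀) :
    Tendsto v atBot (𝓝 0) ∧ ∀ t ≤ t₀, 0 < y t := by
  have hΨc : Continuous minkowskiPsi := lipschitzWith_minkowskiPsi.continuous
  have hΨint : ∀ s t, IntervalIntegrable (fun r => minkowskiPsi (y r)) volume s t := fun s t =>
    (hΨc.comp hyc).intervalIntegrable s t
  have hp0 : ∀ t, 0 ≤ p t := fun t => hμ.le.trans (hpμ t)
  have hgv : ∀ t, g (v t) ≤ 0 := fun t => by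
    rcases (hv0 t).eq_or_lt with h0 | h0
    · rw [← h0, hg0]
    rcases (hvα t).eq_or_lt with h1 | h1
    · rw [h1, hgα]
    exact (hgneg _ ⟨h0, h1⟩).le
  have hgint : ∀ s t, IntervalIntegrable (fun r => -(p r * g (v r))) volume s t := fun s t => by
    have hpint : IntervalIntegrable p volume s t := by
      refine (intervalIntegrable_const (c := (M : ℝ))).mono_fun hpm.aestronglyMeasurable
        (Eventually.of_forall fun r => ?_)
      dsimp only
      rw [Real.norm_of_nonneg (hp0 r)]
      exact (hpM r).trans (le_abs_self _)
    exact (hpint.mul_continuousOn (hg.continuous.comp hvc).continuousOn).neg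
  have hvlim := tendsto_atBot_ciInf hvm ⟨0, by rintro _ ⟨t, rfl⟩; exact hv0 t⟩
  set ℓ := ⨅ t, v t with hℓ
  have hylim := tendsto_atBot_ciInf hym ⟨0, by rintro _ ⟨t, rfl⟩; exact hy0 t⟩
  set m := ⨅ t, y t with hm
  have hℓv : ∀ t, ℓ ≤ v t := fun t => hvm.le_of_tendsto hvlim t
  have hmy : ∀ t, m ≤ y t := fun t => hym.le_of_tendsto hylim t
  have hm0 : m = 0 := by
    refine le_antisymm (not_lt.1 fun hmpos => ?_) (ge_of_tendsto' hylim hy0)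
    refine not_bddBelow_of_linear_growth (U := v) (T := t₀) (minkowskiPsi_pos hmpos)
      (fun s hs => ?_) hv0
    rw [h.fst s t₀ hs le_rfl]
    have := intervalIntegral.integral_mono_on hs
      (intervalIntegrable_const (c := minkowskiPsi m)) (hΨint _ _)
      fun r _ => strictMono_minkowskiPsi.monotone (hmy r)
    simpa [mul_comm] using this
  have hgℓ : ¬ g ℓ < 0 := by
    intro hneg
    obtain ⟨T, hT⟩ := eventually_atBot.1
      (((hg.continuous.tendsto ℓ).comp hvlim).eventually_lt_const
        (show g ℓ < g ℓ / 2 by linarith))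
    refine not_bddBelow_of_linear_growth (U := y) (T := min T t₀) (ε := μ * -(g ℓ / 2))
      (mul_pos hμ (by linarith)) (fun s hs => ?_) hy0
    rw [h.snd s _ hs (min_le_right _ _)]
    have := intervalIntegral.integral_mono_on hs
      (intervalIntegrable_const (c := μ * -(g ℓ / 2))) (hgint _ _)
      fun r hr => by
        have h1 := hT r (hr.2.trans (min_le_left _ _))
        simp only [Function.comp_apply] at h1
        have h2 := hpμ r
        nlinarith
    rw [intervalIntegral.integral_const, smul_eq_mul] at this
    linarith
  have hℓ0 : ℓ = 0 := by
    have h0 : 0 ≤ ℓ := ge_of_tendsto' hvlim hv0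
    refine (h0.eq_or_lt.resolve_right fun hpos => ?_).symm
    rcases (le_of_tendsto' hvlim hvα).eq_or_lt with h1 | h1
    · have hvconst : ∀ t, v t = α := fun t => le_antisymm (hvα t) (h1 ▸ hℓv t)
      have : ∀ s ≤ t₀, y s = y t₀ := fun s hs => by
        have := h.snd s t₀ hs le_rfl
        simp only [hvconst, hgα, mul_zero, neg_zero, intervalIntegral.integral_zero] at this
        linarith
      have h2 : y t₀ ≤ m := ge_of_tendsto hylim (by
        filter_upwards [eventually_le_atBot t₀] with s hs using (this s hs).ge)
      linarith
    · exact hgℓ (hgneg _ ⟨hpos, h1⟩)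
  refine ⟨hℓ0 ▸ hvlim, fun t₁ ht₁ => (hy0 t₁).lt_of_ne fun hy1 => ?_⟩
  -- Monotonicity makes `y` vanish on all of `]-∞, t₁]`, so `v` is constant there and equals its
  -- limit `0`.
  have hv1 : v t₁ = 0 := by
    refine le_antisymm ?_ (hv0 _)
    rw [← hℓ0]
    refine ge_of_tendsto hvlim ?_
    filter_upwards [eventually_le_atBot t₁] with s hs
    have h1 := h.fst s t₁ hs ht₁
    have h2 : ∫ r in s..t₁, minkowskiPsi (y r) = 0 := by
      rw [intervalIntegral.integral_congr (g := fun _ => (0 : ℝ)) fun r hr => ?_]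
      · simp
      · rw [uIcc_of_le hs] at hr
        have : y r = 0 := le_antisymm ((hym hr.2).trans hy1.ge) (hy0 r)
        simp [this]
    linarith
  -- Uniqueness forward from the origin, proved directly because `p` is only measurable: on a window
  -- of length `1 / (2D)` the sum `v + y` is at most half of itself. Finitely many windows reach
  -- `t₀`.
  set D : ℝ := 1 + M * L with hD
  have hDpos : 0 < D := by positivity
  have hstep : ∀ s t, s ≤ t → t ≤ t₀ → t ≤ s + 1 / (2 * D) → v s = 0 → y s = 0 →
      v t = 0 ∧ y t = 0 := by
    intro s t hst ht hts hvs hys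
    have h1 : v t ≤ (t - s) * y t := by
      have h2 := h.fst s t hst ht
      have := intervalIntegral.integral_mono_on hst (hΨint _ _)
        (intervalIntegrable_const (c := y t))
        fun r hr => (minkowskiPsi_le_self (hy0 r)).trans (hym hr.2)
      simp only [intervalIntegral.integral_const, smul_eq_mul] at this
      linarith
    have h2 : y t ≤ (t - s) * (M * (L * v t)) := by
      have h2 := h.snd s t hst ht
      have := intervalIntegral.integral_mono_on hst (hgint _ _)
        (intervalIntegrable_const (c := M * (L * v t)))
        fun r hr => by
          have h3 := hg.dist_le_mul (v r) 0
          rw [hg0, Real.dist_eq, Real.dist_eq, sub_zero, sub_zero, abs_of_nonpos (hgv r),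
            abs_of_nonneg (hv0 r)] at h3
          rw [← mul_neg]
          exact mul_le_mul (hpM r) (h3.trans (mul_le_mul_of_nonneg_left (hvm hr.2) L.2))
            (by linarith [hgv r]) M.2
      simp only [intervalIntegral.integral_const, smul_eq_mul] at this
      linarith
    have h3 : (t - s) * D ≤ 1 / 2 := by
      calc (t - s) * D ≤ 1 / (2 * D) * D := by gcongr; linarith
        _ = 1 / 2 := by field_simp
    have hts0 : 0 ≤ t - s := by linarith
    have hML : (0 : ℝ) ≤ M * L := by positivity
    have h4 : v t + y t ≤ (t - s) * D * (v t + y t) := by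
      have e1 : (t - s) * D * (v t + y t) = (t - s) * y t + (t - s) * (M * (L * v t)) +
        ((t - s) * v t + (t - s) * (M * L) * y t) := by rw [hD]; ring
      have e2 : 0 ≤ (t - s) * v t := mul_nonneg hts0 (hv0 t)
      have e3 : 0 ≤ (t - s) * (M * L) * y t := mul_nonneg (mul_nonneg hts0 hML) (hy0 t)
      linarith
    have h5 := hv0 t
    have h6 := hy0 t
    have h7 : v t + y t ≤ 0 := by nlinarith
    exact ⟨by linarith, by linarith⟩
  have hall : ∀ n : ℕ, ∀ t, t₁ ≤ t → t ≤ t₀ → t ≤ t₁ + n * (1 / (2 * D)) → v t = 0 ∧ y t = 0 := by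
    intro n
    induction n with
    | zero =>
      intro t h1 _ h3
      obtain rfl : t = t₁ := le_antisymm (by simpa using h3) h1
      exact ⟨hv1, hy1.symm⟩
    | succ n ih =>
      intro t h1 h2 h3
      push_cast at h3
      have hpos : 0 ≤ (n : ℝ) * (1 / (2 * D)) := by positivity
      have hs := ih (min t (t₁ + n * (1 / (2 * D)))) (le_min h1 (by linarith))
        ((min_le_left _ _).trans h2) (min_le_right _ _)
      refine hstep _ t (min_le_left _ _) h2 ?_ hs.1 hs.2
      have : 0 < 1 / (2 * D) := by positivity
      rcases min_cases t (t₁ + n * (1 / (2 * D))) with ⟨e, _⟩ | ⟨e, _⟩ <;> rw [e] <;> linarith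
  obtain ⟨n, hn⟩ := exists_nat_ge ((t₀ - t₁) / (1 / (2 * D)))
  rw [div_le_iff₀ (by positivity)] at hn
  exact hyt₀.ne' (hall n t₀ ht₁ le_rfl (by linarith)).2

/-! ### The autonomous orbit after `t₀` -/

/-- On the energy level of the equilibrium `(1, 0)`, the autonomous system has a trajectory that
increases to this equilibrium. -/
theorem exists_autonomous_connection {g Φ : ℝ → ℝ} {L C : ℝ≥0} {κ F₁ t₀ v₀ y₀ : ℝ} (hκ : 0 < κ)
    (hg : LipschitzWith L g) (hgC : ∀ x, |g x| ≤ C) (hg1 : g 1 = 0)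
    (hΦ : ∀ x, HasDerivAt Φ (g x) x) (hΦlt : ∀ x < 1, Φ x < F₁) (hΦ1 : Φ 1 = F₁)
    (hv₀ : v₀ < 1) (hy₀ : 0 < y₀) (hE : Real.sqrt (1 + y₀ ^ 2) = 1 + κ * (F₁ - Φ v₀)) :
    ∃ v y : ℝ → ℝ, IsSystemSolution (fun _ => κ) g v y ∧ v t₀ = v₀ ∧ y t₀ = y₀ ∧
      (∀ t, t₀ ≤ t → v t < 1) ∧ (∀ t, t₀ ≤ t → 0 < y t) ∧ Tendsto v atTop (𝓝 1) := by
  have hκabs : ∀ _ : ℝ, |κ| ≤ (⟨κ, hκ.le⟩ : ℝ≥0) := fun _ => (abs_of_pos hκ).le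
  obtain ⟨v, y, hsol, hv, hy⟩ := exists_isSystemSolution continuous_const hκabs hg hgC t₀ v₀ y₀
  have hen : ∀ t, Real.sqrt (1 + y t ^ 2) = 1 + κ * (F₁ - Φ (v t)) := by
    have hd := fun t => hsol.hasDerivAt_energy hΦ κ t
    intro t
    have := is_const_of_deriv_eq_zero (fun t => (hd t).differentiableAt)
      (fun t => by rw [(hd t).deriv]; simp) t t₀
    simp only [hv, hy, hE] at this
    linarith
  have hv1 : ∀ t, t₀ ≤ t → v t < 1 := by
    intro t ht
    by_contra! hge
    obtain ⟨s, hs, hvs⟩ := intermediate_value_Icc ht hsol.continuous_fst.continuousOn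
      ⟨hv.le.trans hv₀.le, hge⟩
    -- On this energy level `v = 1` forces `y = 0`, so the orbit would be the equilibrium itself.
    have hys : y s = 0 := by
      by_contra hne
      have := one_lt_sqrt_one_add_sq hne
      rw [hen s, hvs, hΦ1] at this
      simp at this
    have heq : IsSystemSolution (fun _ => κ) g (fun _ => 1) (fun _ => 0) := fun t =>
      ⟨by simpa using hasDerivAt_const t (1 : ℝ), by simpa [hg1] using hasDerivAt_const t (0 : ℝ)⟩
    have := (hsol.unique hκabs hg heq hvs hys t₀).1
    exact hv₀.ne (hv ▸ this)
  have hyne : ∀ t, t₀ ≤ t → y t ≠ 0 := fun t ht h0 => by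
    have h1 := hen t
    have h2 := mul_pos hκ (sub_pos.2 (hΦlt _ (hv1 t ht)))
    rw [h0] at h1
    norm_num at h1
    rcases h1 with h1 | h1
    · exact hκ.ne' h1
    · exact (hΦlt _ (hv1 t ht)).ne' (sub_eq_zero.1 h1)
  have hypos : ∀ t, t₀ ≤ t → 0 < y t := by
    intro t ht
    by_contra! hle
    obtain ⟨s, hs, hys⟩ := intermediate_value_Icc' ht hsol.continuous_snd.continuousOn
      ⟨hle, hy ▸ hy₀.le⟩
    exact hyne s hs.1 hys
  refine ⟨v, y, hsol, hv, hy, hv1, hypos, ?_⟩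
  have hmono : MonotoneOn v (Ici t₀) := by
    refine monotoneOn_of_deriv_nonneg (convex_Ici t₀) hsol.continuous_fst.continuousOn
      (fun t _ => (hsol t).1.differentiableAt.differentiableWithinAt) fun t ht => ?_
    rw [interior_Ici, mem_Ioi] at ht
    rw [(hsol t).1.deriv]
    exact (minkowskiPsi_pos (hypos t ht.le)).le
  have hmono' : Monotone fun t => v (max t t₀) := fun s t hst =>
    hmono (le_max_right s t₀) (le_max_right t t₀) (max_le_max_right _ hst)
  have hlim := tendsto_atTop_ciSup hmono'
    ⟨1, by rintro _ ⟨t, rfl⟩; exact (hv1 _ (le_max_right _ _)).le⟩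
  set ℓ := ⨆ t, v (max t t₀) with hℓ
  have hvlim : Tendsto v atTop (𝓝 ℓ) := hlim.congr' (by
    filter_upwards [eventually_ge_atTop t₀] with t ht
    rw [max_eq_left ht])
  have hℓ1 : ℓ ≤ 1 := le_of_tendsto' hlim fun t => (hv1 _ (le_max_right _ _)).le
  rcases hℓ1.eq_or_lt with h1 | h1
  · rwa [h1] at hvlim
  exfalso
  -- If `v` stopped at `ℓ < 1`, the energy identity and `√(1 + y²) ≤ 1 + y` would keep `y` above `ε
  -- / 2`, and `v` would grow linearly.
  set ε := κ * (F₁ - Φ ℓ) with hε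
  have hεpos : 0 < ε := mul_pos hκ (sub_pos.2 (hΦlt _ h1))
  have hWlim : Tendsto (fun t => κ * (F₁ - Φ (v t))) atTop (𝓝 ε) :=
    (((hΦ ℓ).continuousAt.tendsto.comp hvlim).const_sub F₁).const_mul κ
  obtain ⟨T, hT⟩ := eventually_atTop.1 ((hWlim.eventually_const_lt
    (show ε / 2 < ε by linarith)).and (eventually_ge_atTop t₀))
  have hyε : ∀ t, T ≤ t → ε / 2 ≤ y t := fun t ht => by
    have h2 := hen t
    have h3 := sqrt_one_add_sq_le (hypos t (hT t ht).2).le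
    linarith [(hT t ht).1]
  have hgrow : ∀ t, T ≤ t → minkowskiPsi (ε / 2) * (t - T) ≤ v t - v T := fun t ht => by
    refine (convex_Ici T).mul_sub_le_image_sub_of_le_deriv hsol.continuous_fst.continuousOn
      (fun t _ => (hsol t).1.differentiableAt.differentiableWithinAt) (fun t ht => ?_)
      T self_mem_Ici t ht ht
    rw [interior_Ici, mem_Ioi] at ht
    rw [(hsol t).1.deriv]
    exact strictMono_minkowskiPsi.monotone (hyε t ht.le)
  have hψ : 0 < minkowskiPsi (ε / 2) := minkowskiPsi_pos (by linarith)
  have h4 : Tendsto (fun t => minkowskiPsi (ε / 2) * (t - T)) atTop atTop :=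
    (tendsto_atTop_add_const_right _ (-T) tendsto_id).const_mul_atTop hψ
  obtain ⟨t, ht1, ht2⟩ := ((h4.eventually_gt_atTop (1 - v T)).and
    (eventually_ge_atTop T)).exists
  linarith [hgrow t ht2, hv1 t ((hT t ht2).2)]

/-! ### Truncated reaction terms and their primitives -/

/-- The restriction of `f` to `[0, a]`, extended by constants. -/
def clampExt (f : ℝ → ℝ) (a x : ℝ) : ℝ := f (max 0 (min x a))

section ClampExt

variable {f : ℝ → ℝ} {a x : ℝ} {L : ℝ≥0}

theorem clampExt_of_mem (hx : x ∈ Icc 0 a) : clampExt f a x = f x := by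
  simp [clampExt, hx.1, hx.2]

theorem clampExt_of_nonpos (hx : x ≤ 0) : clampExt f a x = f 0 := by
  simp [clampExt, hx]

theorem clampExt_of_ge (ha : 0 ≤ a) (hx : a ≤ x) : clampExt f a x = f a := by
  simp [clampExt, hx, ha]

theorem lipschitzWith_clampExt (hf : LipschitzOnWith L f (Icc 0 1)) (ha1 : a ≤ 1) :
    LipschitzWith L (clampExt f a) := by
  have hk : LipschitzWith 1 fun x : ℝ => max 0 (min x a) :=
    (LipschitzWith.id.min_const a).const_max 0
  have hmem : ∀ x : ℝ, max 0 (min x a) ∈ Icc (0 : ℝ) 1 := fun x =>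
    ⟨le_max_left _ _, max_le zero_le_one ((min_le_right _ _).trans ha1)⟩
  refine LipschitzWith.of_dist_le_mul fun x y => (hf.dist_le_mul _ (hmem x) _ (hmem y)).trans ?_
  have := hk.dist_le_mul x y
  rw [NNReal.coe_one, one_mul] at this
  gcongr

theorem abs_clampExt_le (hf : LipschitzOnWith L f (Icc 0 1)) (hf0 : f 0 = 0) (ha1 : a ≤ 1)
    (x : ℝ) : |clampExt f a x| ≤ L := by
  have hmem : max 0 (min x a) ∈ Icc (0 : ℝ) 1 :=
    ⟨le_max_left _ _, max_le zero_le_one ((min_le_right _ _).trans ha1)⟩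
  have := hf.dist_le_mul _ hmem 0 ⟨le_rfl, zero_le_one⟩
  rw [hf0, Real.dist_eq, Real.dist_eq, sub_zero, sub_zero, abs_of_nonneg hmem.1] at this
  exact this.trans (mul_le_of_le_one_right L.2 hmem.2)

theorem hasDerivAt_primitiveF {g : ℝ → ℝ} (hg : Continuous g) (x : ℝ) :
    HasDerivAt (primitiveF g) (g x) x :=
  intervalIntegral.integral_hasDerivAt_right (hg.intervalIntegrable _ _)
    hg.stronglyMeasurable.stronglyMeasurableAtFilter hg.continuousAt

theorem primitiveF_clampExt (hx : x ∈ Icc 0 a) :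
    primitiveF (clampExt f a) x = primitiveF f x := by
  refine intervalIntegral.integral_congr fun s hs => ?_
  rw [uIcc_of_le hx.1] at hs
  exact clampExt_of_mem ⟨hs.1, hs.2.trans hx.2⟩

theorem primitiveF_clampExt_of_ge (hc : Continuous (clampExt f a)) (ha : 0 ≤ a) (hfa : f a = 0)
    (hx : a ≤ x) : primitiveF (clampExt f a) x = primitiveF (clampExt f a) a := by
  unfold primitiveF
  rw [← intervalIntegral.integral_add_adjacent_intervals (b := a) (hc.intervalIntegrable _ _)
    (hc.intervalIntegrable _ _), intervalIntegral.integral_congr (a := a) (g := fun _ => 0)]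
  · simp
  · intro s hs
    rw [uIcc_of_le hx] at hs
    simp [clampExt_of_ge ha hs.1, hfa]

end ClampExt

namespace IsBistable

variable {f : ℝ → ℝ} {α : ℝ} {L : ℝ≥0}

theorem clampExt_nonpos (hf : IsBistable f α) (x : ℝ) : clampExt f α x ≤ 0 := by
  rcases le_or_gt x 0 with h0 | h0
  · rw [clampExt_of_nonpos h0, hf.map_zero]
  rcases le_or_gt α x with h1 | h1
  · rw [clampExt_of_ge hf.alpha_mem.1.le h1, hf.map_alpha]
  rw [clampExt_of_mem ⟨h0.le, h1.le⟩]
  exact (hf.neg x ⟨h0, h1⟩).le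

theorem primitiveF_nonpos (hf : IsBistable f α) {x : ℝ} (hx : x ∈ Icc 0 α) :
    primitiveF f x ≤ 0 := by
  rw [← primitiveF_clampExt hx]
  have h := intervalIntegral.integral_nonneg (μ := volume) hx.1
    fun s _ => neg_nonneg.2 (hf.clampExt_nonpos s)
  rw [intervalIntegral.integral_neg] at h
  exact neg_nonneg.1 h

/-- The primitive is `0` left of the origin, nonpositive up to `α`, and strictly increasing from `α`
to `1`. -/
theorem primitiveF_clampExt_lt (hf : IsBistable f α) (hL : LipschitzOnWith L f (Icc 0 1))
    (hF : 0 < primitiveF f 1) {x : ℝ} (hx : x < 1) :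
    primitiveF (clampExt f 1) x < primitiveF f 1 := by
  have hc := (lipschitzWith_clampExt hL le_rfl).continuous
  rcases le_or_gt x 0 with h0 | h0
  · have : primitiveF (clampExt f 1) x = 0 := by
      unfold primitiveF
      rw [intervalIntegral.integral_congr (g := fun _ => 0)]
      · simp
      · intro s hs
        rw [uIcc_of_ge h0] at hs
        simp [clampExt_of_nonpos hs.2, hf.map_zero]
    rwa [this]
  have h1 : primitiveF (clampExt f 1) x = primitiveF f x := primitiveF_clampExt ⟨h0.le, hx.le⟩
  rcases le_or_gt x α with h2 | h2
  · rw [h1]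
    exact (hf.primitiveF_nonpos ⟨h0.le, h2⟩).trans_lt hF
  have h3 : primitiveF (clampExt f 1) 1 = primitiveF f 1 :=
    primitiveF_clampExt ⟨zero_le_one, le_rfl⟩
  rw [← h3, ← sub_pos]
  unfold primitiveF
  rw [intervalIntegral.integral_interval_sub_left (hc.intervalIntegrable _ _)
    (hc.intervalIntegrable _ _)]
  refine intervalIntegral.intervalIntegral_pos_of_pos_on (hc.intervalIntegrable _ _)
    (fun s hs => ?_) hx
  rw [clampExt_of_mem ⟨(h0.trans hs.1).le, hs.2.le⟩]
  exact hf.pos s ⟨h2.trans hs.1, hs.2⟩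

end IsBistable

/-! ### Representative of the weight, gluing and conclusion -/

/-- An essentially bounded function on a half-line with a lower bound agrees almost everywhere
with a measurable function that obeys the bounds everywhere. -/
theorem exists_measurable_bounded_rep {q : ℝ → ℝ} {η t₀ : ℝ}
    (hq : MemLp q ∞ (volume.restrict (Iio t₀)))
    (hqη : ∀ᵐ t ∂(volume.restrict (Iio t₀)), η ≤ q t) :
    ∃ (p : ℝ → ℝ) (M : ℝ), Measurable p ∧ (∀ t, η ≤ p t) ∧ (∀ t, p t ≤ M) ∧
      ∀ᵐ t ∂(volume.restrict (Iio t₀)), p t = q t := by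
  set E := eLpNormEssSup q (volume.restrict (Iio t₀)) with hE
  have hEtop : E ≠ ∞ := by
    have := hq.2
    rw [eLpNorm_exponent_top] at this
    exact this.ne
  set N := max η E.toReal
  refine ⟨fun t => max η (min (hq.1.mk q t) N), N,
    measurable_const.max (hq.1.stronglyMeasurable_mk.measurable.min measurable_const),
    fun t => le_max_left _ _, fun t => max_le (le_max_left _ _) (min_le_right _ _), ?_⟩
  filter_upwards [hqη, hq.1.ae_eq_mk, ae_le_eLpNormEssSup (f := q)] with t h1 h2 h3
  have h4 : q t ≤ E.toReal := by
    have := ENNReal.toReal_mono hEtop h3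
    rw [toReal_enorm] at this
    exact (le_abs_self _).trans this
  rw [← h2, min_eq_left (h4.trans (le_max_right _ _)), max_eq_right h1]

/-- At the junction only a left derivative is available for the left piece, as its equations stop at
`t₀`. -/
theorem hasDerivAt_of_le_of_ge {v l r : ℝ → ℝ} {t₀ d t : ℝ} (hl : ∀ s ≤ t₀, v s = l s)
    (hr : ∀ s, t₀ ≤ s → v s = r s) (hdl : t ≤ t₀ → HasDerivWithinAt l d (Iic t₀) t)
    (hdr : t₀ ≤ t → HasDerivAt r d t) : HasDerivAt v d t := by
  have h1 : t ≤ t₀ → HasDerivWithinAt v d (Iic t₀) t := fun h => (hdl h).congr hl (hl t h)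
  have h2 : t₀ ≤ t → HasDerivWithinAt v d (Ici t₀) t := fun h =>
    (hdr h).hasDerivWithinAt.congr hr (hr t h)
  rcases lt_trichotomy t t₀ with h | rfl | h
  · exact (h1 h.le).hasDerivAt (Iic_mem_nhds h)
  · have := (h1 le_rfl).union (h2 le_rfl)
    rwa [Iic_union_Ici, hasDerivWithinAt_univ] at this
  · exact (h2 h.le).hasDerivAt (Ici_mem_nhds h)

/-- A solution of the integrated system up to `t₀` and a solution of the autonomous system after
`t₀` with the same data at `t₀` combine to a heteroclinic solution. -/
theorem isHeteroclinic_of_glue {δ t₀ c η M : ℝ} {q p f gl gr vl yl vr yr : ℝ → ℝ} {K K' : ℝ≥0}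
    (hδ : 0 < δ) (hpm : Measurable p) (hpη : ∀ t, η ≤ p t) (hpM : ∀ t, p t ≤ M)
    (hpq : ∀ᵐ t ∂(volume.restrict (Iio t₀)), δ * p t = q t) (hqc : ∀ t ∈ Ici t₀, q t = c)
    (hglc : Continuous gl) (hl : IsIntegralSolutionOn p gl vl yl t₀)
    (hvl : LipschitzWith K vl) (hyl : LipschitzWith K yl) (hylpos : ∀ t ≤ t₀, 0 < yl t)
    (hvlbot : Tendsto vl atBot (𝓝 0)) (hgl : ∀ t, gl (vl t) = f (vl t))
    (hr : IsSystemSolution (fun _ => c / δ) gr vr yr) (hyr : LipschitzWith K' yr)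
    (hyrpos : ∀ t, t₀ ≤ t → 0 < yr t) (hvrtop : Tendsto vr atTop (𝓝 1))
    (hgr : ∀ x ∈ Icc (0 : ℝ) 1, gr x = f x) (hv₀ : vr t₀ = vl t₀) (hy₀ : yr t₀ = yl t₀) :
    ∃ v : ℝ → ℝ, IsHeteroclinic δ q f v := by
  have hΨc : Continuous minkowskiPsi := lipschitzWith_minkowskiPsi.continuous
  -- One summand is always constant in time, so the gluing needs no case split; the same formula for
  -- `y` makes it Lipschitz as a sum.
  set v : ℝ → ℝ := fun t => vl (min t t₀) + (vr (max t t₀) - vl t₀) with hv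
  set y : ℝ → ℝ := fun t => yl (min t t₀) + (yr (max t t₀) - yl t₀) with hy
  have hvle : ∀ t ≤ t₀, v t = vl t := fun t ht => by simp [hv, ht, hv₀]
  have hvge : ∀ t, t₀ ≤ t → v t = vr t := fun t ht => by simp [hv, ht]
  have hyle : ∀ t ≤ t₀, y t = yl t := fun t ht => by simp [hy, ht, hy₀]
  have hyge : ∀ t, t₀ ≤ t → y t = yr t := fun t ht => by simp [hy, ht]
  have hyL : LipschitzWith (K + (K' + 0)) y := by
    have h1 := hyl.comp (LipschitzWith.id.min_const t₀)
    have h2 := hyr.comp (LipschitzWith.id.max_const t₀)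
    rw [mul_one] at h1 h2
    exact h1.add (h2.sub (LipschitzWith.const _))
  have hypos : ∀ t, 0 < y t := fun t => by
    rcases le_total t t₀ with h | h
    · rw [hyle t h]; exact hylpos t h
    · rw [hyge t h]; exact hyrpos t h
  have hder : ∀ t, HasDerivAt v (minkowskiPsi (y t)) t := fun t => by
    refine hasDerivAt_of_le_of_ge hvle hvge (fun ht => ?_) fun ht => ?_
    · rw [hyle t ht]
      have hc := hΨc.comp hyl.continuous
      have h1 : HasDerivAt (fun s => vl t₀ + ∫ r in t₀..s, minkowskiPsi (yl r))
          (minkowskiPsi (yl t)) t :=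
        (intervalIntegral.integral_hasDerivAt_right (hc.intervalIntegrable _ _)
          hc.stronglyMeasurable.stronglyMeasurableAtFilter hc.continuousAt).const_add _
      have h2 : ∀ s ≤ t₀, vl s = vl t₀ + ∫ r in t₀..s, minkowskiPsi (yl r) := fun s hs => by
        rw [intervalIntegral.integral_symm, ← hl.fst s t₀ hs le_rfl]
        ring
      exact h1.hasDerivWithinAt.congr h2 (h2 t ht)
    · rw [hyge t ht]
      exact (hr t).1
  have hderiv : deriv v = fun t => minkowskiPsi (y t) := funext fun t => (hder t).deriv
  have hmono : StrictMono v := strictMono_of_deriv_pos fun t => by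
    rw [hderiv]; exact minkowskiPsi_pos (hypos t)
  have hbot : Tendsto v atBot (𝓝 0) := hvlbot.congr' (by
    filter_upwards [eventually_le_atBot t₀] with t ht using (hvle t ht).symm)
  have htop : Tendsto v atTop (𝓝 1) := hvrtop.congr' (by
    filter_upwards [eventually_ge_atTop t₀] with t ht using (hvge t ht).symm)
  have hmem : ∀ t, v t ∈ Icc (0 : ℝ) 1 := fun t =>
    ⟨hmono.monotone.le_of_tendsto hbot t, hmono.monotone.ge_of_tendsto htop t⟩
  refine ⟨v, ⟨⟨contDiff_one_iff_deriv.2 ⟨fun t => (hder t).differentiableAt, ?_⟩, hmem, fun t => ?_,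
    fun a b => ?_, ?_⟩, hmono, hbot, htop⟩⟩
  · rw [hderiv]; exact hΨc.comp hyL.continuous
  · rw [hderiv]; exact abs_minkowskiPsi_lt_one _
  · rw [hderiv]
    exact (lipschitzWith_minkowskiPsi.comp hyL).lipschitzOnWith.absolutelyContinuousOnInterval
  have hloc : LocallyIntegrable (fun r => -(p r * gl (vl r))) volume := by
    have h1 : LocallyIntegrable p volume := by
      refine (locallyIntegrable_const (max |η| |M|)).mono hpm.aestronglyMeasurable
        (Eventually.of_forall fun t => ?_)
      rw [Real.norm_eq_abs, Real.norm_eq_abs, abs_of_nonneg (le_max_of_le_left (abs_nonneg η))]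
      exact abs_le_max_abs_abs (hpη t) (hpM t)
    have h2 := h1.locallyIntegrableOn univ
    have h3 := h2.mul_continuousOn (g := fun r => gl (vl r))
      (hglc.comp hvl.continuous).continuousOn isOpen_univ.isLocallyClosed
    exact (locallyIntegrableOn_univ.1 h3).neg
  -- The weight may jump at `t₀`, so `y` may have a corner there.
  have hne : ∀ᵐ t : ℝ, t ≠ t₀ := by simp [ae_iff, measure_singleton]
  rw [ae_restrict_iff' measurableSet_Iio] at hpq
  filter_upwards [LocallyIntegrable.ae_hasDerivAt_integral hloc, hne, hpq] with t h1 h2 h3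
  have hφ : (fun s => minkowskiPhi (deriv v s)) = y := by
    rw [hderiv]; exact funext fun s => minkowskiPhi_minkowskiPsi _
  rw [hφ]
  rcases h2.lt_or_gt with h | h
  · refine ⟨-(p t * gl (vl t)), ?_, ?_⟩
    · refine ((h1 t₀).const_add (yl t₀)).congr_of_eventuallyEq ?_
      filter_upwards [Iic_mem_nhds h] with s hs
      rw [hyle s hs, intervalIntegral.integral_symm, ← hl.snd s t₀ hs le_rfl]
      ring
    · rw [hvle t h.le, hgl, ← h3 h]
      ring
  · refine ⟨-(c / δ * gr (vr t)), ?_, ?_⟩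
    · refine (hr t).2.congr_of_eventuallyEq ?_
      filter_upwards [Ici_mem_nhds h] with s hs using hyge s hs
    · rw [hqc t h.le, ← hvge t h.le, hgr _ (hmem t)]
      field_simp
      ring

theorem mainTheorem1
    (δ : ℝ) (hδ : 0 < δ)
    (t₀ : ℝ) (q : ℝ → ℝ) (hq : MemLp q ∞ (volume.restrict (Iio t₀)))
    (η : ℝ) (hη : 0 < η) (hqη : ∀ᵐ t ∂(volume.restrict (Iio t₀)), η ≤ q t)
    (c : ℝ) (hc : 0 < c) (hqc : ∀ t ∈ Ici t₀, q t = c)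
    (f : ℝ → ℝ) (hLip : ∃ L : ℝ≥0, LipschitzOnWith L f (Icc 0 1))
    (α : ℝ) (hf1 : IsBistable f α)
    (hf2 : 0 < primitiveF f 1)
    (hcond : c ≤ η * (-primitiveF f α / (primitiveF f 1 - primitiveF f α))) :
    ∃ v : ℝ → ℝ, IsHeteroclinic δ q f v := by
  obtain ⟨L, hL⟩ := hLip
  obtain ⟨q', M, hq'm, hq'η, hq'M, hq'q⟩ := exists_measurable_bounded_rep hq hqη
  have hα0 := hf1.alpha_mem.1
  have hα1 := hf1.alpha_mem.2
  have hglL := lipschitzWith_clampExt hL hα1.le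
  have hgrL := lipschitzWith_clampExt hL le_rfl
  have hM : 0 ≤ M := hη.le.trans ((hq'η 0).trans (hq'M 0))
  have hκ : 0 < c / δ := div_pos hc hδ
  have hFα : primitiveF (clampExt f α) α = primitiveF f α := primitiveF_clampExt ⟨hα0.le, le_rfl⟩
  have hFα0 : primitiveF f α ≤ 0 := hf1.primitiveF_nonpos ⟨hα0.le, le_rfl⟩
  have hgl0 : clampExt f α 0 = 0 := by rw [clampExt_of_nonpos le_rfl, hf1.map_zero]
  have hpη : ∀ t, η / δ ≤ q' t / δ := fun t => div_le_div_of_nonneg_right (hq'η t) hδ.le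
  have hpM : ∀ t, q' t / δ ≤ (⟨M / δ, div_nonneg hM hδ.le⟩ : ℝ≥0) := fun t =>
    div_le_div_of_nonneg_right (hq'M t) hδ.le
  obtain ⟨vl, yl, hl, hvl, hyl, hvlm, hylm, hvl0, hvlα, hyl0, hE⟩ :=
    exists_integralSolution (t₀ := t₀) (hq'm.div_const δ) (div_pos hη hδ).le hpη hpM hglL
      (abs_clampExt_le hL hf1.map_zero hα1.le) hgl0 hf1.clampExt_nonpos
      (hasDerivAt_primitiveF hglL.continuous) (by simp [primitiveF]) hα1.le
      (fun x hx => primitiveF_clampExt_of_ge hglL.continuous hα0.le hf1.map_alpha hx) hf2 hκ (by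
        rw [hFα]
        -- Clearing the positive denominator `F(1) - F(α)` and dividing by `δ` turns the bound on
        -- `c` into the energy comparison.
        rw [mul_div_assoc', le_div_iff₀ (by linarith)] at hcond
        rw [div_mul_eq_mul_div, div_mul_eq_mul_div, ← neg_div]
        exact div_le_div_of_nonneg_right (by linarith) hδ.le)
  have hvl₀ : vl t₀ < 1 := (hvlα t₀).trans_lt hα1
  -- Since `vl t₀ ∈ [0, α]`, the truncations at `α` and at `1` have the same primitive there, so the
  -- landing condition is the energy level required on the right.
  rw [primitiveF_clampExt ⟨hvl0 t₀, hvlα t₀⟩,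
    ← primitiveF_clampExt (a := 1) ⟨hvl0 t₀, hvl₀.le⟩] at hE
  have hyl₀ : 0 < yl t₀ := by
    refine (hyl0 t₀).lt_of_ne fun h => ?_
    have h1 := mul_pos hκ (sub_pos.2 (hf1.primitiveF_clampExt_lt hL hf2 hvl₀))
    rw [← h] at hE
    norm_num at hE
    rcases hE with (h2 | h2) | h2
    · exact hc.ne' h2
    · exact hδ.ne' h2
    · rw [h2] at h1
      simp at h1
  obtain ⟨hvlbot, hylpos⟩ := hl.properties (hq'm.div_const δ) (div_pos hη hδ) hpη hpM hglL hgl0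
    (by rw [clampExt_of_ge hα0.le le_rfl, hf1.map_alpha])
    (fun x hx => by rw [clampExt_of_mem ⟨hx.1.le, hx.2.le⟩]; exact hf1.neg x hx)
    hvl.continuous hyl.continuous hvlm hylm hvl0 hvlα hyl0 hyl₀
  obtain ⟨vr, yr, hr, hvr₀, hyr₀, -, hyrpos, hvrtop⟩ :=
    exists_autonomous_connection (t₀ := t₀) hκ hgrL (abs_clampExt_le hL hf1.map_zero le_rfl)
      (by rw [clampExt_of_ge zero_le_one le_rfl, hf1.map_one])
      (hasDerivAt_primitiveF hgrL.continuous) (fun x hx => hf1.primitiveF_clampExt_lt hL hf2 hx)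
      (primitiveF_clampExt ⟨zero_le_one, le_rfl⟩) hvl₀ hyl₀ hE
  refine isHeteroclinic_of_glue hδ (hq'm.div_const δ) hpη hpM ?_ hqc hglL.continuous hl hvl hyl
    hylpos hvlbot (fun t => clampExt_of_mem ⟨hvl0 t, hvlα t⟩) hr
    (hr.lipschitzWith_snd (M := ⟨c / δ, hκ.le⟩) (fun _ => (abs_of_pos hκ).le)
      (abs_clampExt_le hL hf1.map_zero le_rfl)) hyrpos hvrtop (fun x hx => clampExt_of_mem hx)
    hvr₀ hyr₀
  filter_upwards [hq'q] with t ht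
  rw [mul_div_cancel₀ _ hδ.ne', ht]
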